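/- For integers $k,g\ge 3$, a $(k,g)$-graph is a finite simple $k$-regular graph of girth exactly $g$; its order is its number of vertices. The $(k,g)$-spectrum is the set of orders of connected $(k,g)$-graphs. Call an order $n$ admissible for $k$ if $k$ is even or $n$ is even, and let $N(k,g)$ be the smallest admissible $N$ such that a $(k,g)$-graph of order $n$ exists for every admissible $n\ge N$. Then: - the $(5,3)$-spectrum is $\{n : n \text{ even},\ n\ge 6\}$, and $N(5,3)=6$; - the $(5,4)$-spectrum is $\{n : n \text{ even},\ n\ge 10\}$, and $N(5,4)=10$; - the $(5,6)$-spectrum is $\{42\}\cup\{n : n \text{ even},\ n\ge 46\}$, there is no $(5,6)$-graph of order $44$ (connected or not), and $N(5,6)=46$; - the $(6,3)$-spectrum is $\{n : n\ge 7\}$, and $N(6,3)=7$; - the $(6,4)$-spectrum is $\{12\}\cup\{n : n\ge 14\}$, there is no $(6,4)$-graph of order $13$ (connected or not), and $N(6,4)=14$; - the $(7,3)$-spectrum is $\{n : n \text{ even},\ n\ge 8\}$, and $N(7,3)=8$; - the $(7,4)$-spectrum is $\{n : n \text{ even},\ n\ge 14\}$, and $N(7,4)=14$. -/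

import Mathlib

/-- `G` is a `(k,g)`-graph: it is `k`-regular and its shortest cycle has length exactly `g`. -/
def IsKGGraph {V : Type*} (G : SimpleGraph V) [G.LocallyFinite] (k g : ℕ) : Prop :=
  G.IsRegularOfDegree k ∧ G.egirth = (g : ℕ∞)

open Classical in
/-- The orders of all `(k,g)`-graphs, connected or not. -/
def kgOrders (k g : ℕ) : Set ℕ :=
  {n | ∃ G : SimpleGraph (Fin n), IsKGGraph G k g}

open Classical in
/-- The `(k,g)`-spectrum: the orders of the connected `(k,g)`-graphs. -/
def kgSpectrum (k g : ℕ) : Set ℕ :=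
  {n | ∃ G : SimpleGraph (Fin n), G.Connected ∧ IsKGGraph G k g}

/-- The orders that degree `k` allows: all orders if `k` is even, the even ones if `k` is odd. -/
def AdmissibleOrder (k n : ℕ) : Prop := Odd k → Even n

/-- `N = N(k,g)`: the smallest admissible order from which on `(k,g)`-graphs of every admissible
order exist. -/
def IsKGThreshold (k g N : ℕ) : Prop :=
  IsLeast {M : ℕ | AdmissibleOrder k M ∧
    ∀ n : ℕ, M ≤ n → AdmissibleOrder k n → n ∈ kgOrders k g} N

/-!
Circulant graphs realise girth 3, and girth 4 in even degree `k` at the orders from `3 k - 2` on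
(for `k = 6` also at 15). The other orders are those of bipartite Haar graphs of a subset `S` of
`ℤ/m`. Such a graph has no 4-cycle when `S` is a Sidon set: the Golomb ruler `{0, 1, 4, 9, 11}` of
length 11 works for every `m ≥ 23`, and for `m = 21` there is the perfect difference set
`{0, 1, 4, 14, 16}`.

The lower bounds are Moore bounds, so that only two orders need an argument of their own. A
triangle-free 6-regular graph on 13 vertices would be bipartite by the theorem of Andrásfai, Erdős
and Sós, which is impossible for odd order. A 5-regular graph of girth 6 on 44 vertices has two
vertices more than the Moore bound. The edges far from a fixed vertex then form a star, which makes
the graph bipartite, and each vertex `x` has exactly one antipode `P x`, the vertex on its own side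
without a common neighbour. Hence the biadjacency matrix `N` satisfies `N Nᵀ = (k - 1) I + J - P`.
For `k = 5` the determinant of the right-hand side is `5` times a square, but it would have to be
the square `(det N)²`.
-/

open SimpleGraph Finset Function Matrix

section Girth

variable {V : Type*} {G : SimpleGraph V}

theorem natCast_le_egirth_iff_cycleGraph_free {n : ℕ} :
    n ≤ G.egirth ↔ ∀ m, 3 ≤ m → m < n → (cycleGraph m).Free G := by
  rw [le_egirth]
  constructor
  · intro h m hm hmn hcontained
    obtain ⟨v, p, hp, rfl⟩ := (cycleGraph_isContained_iff hm).1 hcontained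
    exact hmn.not_ge (by exact_mod_cast h v p hp)
  · intro h v p hp
    by_contra! hlt
    exact h p.length hp.three_le_length (by exact_mod_cast hlt)
      ((cycleGraph_isContained_iff hp.three_le_length).2 ⟨v, p, hp, rfl⟩)

theorem egirth_le_of_injective {n : ℕ} {f : Fin (n + 3) → V} (hf : Injective f)
    (hadj : ∀ i, G.Adj (f i) (f (i + 1))) : G.egirth ≤ n + 3 := by
  have hhom : ∀ i j, (cycleGraph (n + 3)).Adj i j → G.Adj (f i) (f j) := by
    intro i j hij
    rcases cycleGraph_adj.1 hij with h | h
    · simpa [sub_eq_iff_eq_add'.1 h, add_comm] using (hadj j).symm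
    · simpa [sub_eq_iff_eq_add'.1 h, add_comm] using hadj i
  obtain ⟨v, p, hp, hlen⟩ := (cycleGraph_isContained_iff (n := n + 3) (by lia)).1
    ⟨⟨⟨f, hhom _ _⟩, hf⟩⟩
  exact_mod_cast hlen ▸ egirth_le_length hp

theorem four_le_egirth_iff_cliqueFree_three : 4 ≤ G.egirth ↔ G.CliqueFree 3 := by
  have hfree : G.CliqueFree 3 ↔ (cycleGraph 3).Free G := by
    simpa [cycleGraph_three_eq_top] using cliqueFree_iff_top_free (G := G) (β := Fin 3)
  rw [hfree]
  refine (natCast_le_egirth_iff_cycleGraph_free (n := 4)).trans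
    ⟨fun h => h 3 le_rfl (by lia), fun h m hm hm4 => ?_⟩
  obtain rfl : m = 3 := by lia
  exact h

theorem egirth_le_four {a b c d : V} (hab : G.Adj a b) (hbc : G.Adj b c) (hcd : G.Adj c d)
    (hda : G.Adj d a) (hac : a ≠ c) (hbd : b ≠ d) : G.egirth ≤ 4 := by
  refine egirth_le_of_injective (n := 1) (f := ![a, b, c, d]) ?_ ?_
  · simp only [← List.nodup_ofFn, List.ofFn_succ]
    simp [hab.ne, hbc.ne, hcd.ne, hda.ne', hac, hbd]
  · simp [Fin.forall_fin_succ, hab, hbc, hcd, hda]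

theorem egirth_le_five {a b c d e : V} (hab : G.Adj a b) (hbc : G.Adj b c) (hcd : G.Adj c d)
    (hde : G.Adj d e) (hea : G.Adj e a) (h : [a, b, c, d, e].Nodup) : G.egirth ≤ 5 := by
  refine egirth_le_of_injective (n := 2) (f := ![a, b, c, d, e]) ?_ ?_
  · simpa [← List.nodup_ofFn] using h
  · simp [Fin.forall_fin_succ, hab, hbc, hcd, hde, hea]

theorem eq_of_adj_of_adj (hG : 5 ≤ G.egirth) {u z v w : V} (huz : u ≠ z) (huv : G.Adj u v)
    (hzv : G.Adj z v) (huw : G.Adj u w) (hzw : G.Adj z w) : v = w := by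
  by_contra hvw
  exact absurd (hG.trans (egirth_le_four huv hzv.symm hzw huw.symm huz hvw)) (by decide)

theorem even_of_cycleGraph_isContained {m : ℕ} (hG : G.IsBipartite) (hm : 2 ≤ m)
    (h : cycleGraph m ⊑ G) : Even m := by
  obtain ⟨φ⟩ := h
  by_contra hodd
  have := (hG.of_hom φ.toHom).chromaticNumber_le
  rw [chromaticNumber_cycleGraph_of_odd m hm (Nat.not_even_iff_odd.1 hodd)] at this
  exact absurd this (by decide)

theorem four_le_egirth_of_isBipartite (hG : G.IsBipartite) : 4 ≤ G.egirth := by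
  refine natCast_le_egirth_iff_cycleGraph_free.2 fun m hm hm4 h => ?_
  have := even_of_cycleGraph_isContained hG (by lia) h
  grind

theorem six_le_egirth_of_isBipartite (hG : G.IsBipartite) (h4 : ∀ ⦃a b c d⦄,
    G.Adj a b → G.Adj b c → G.Adj c d → G.Adj d a → a = c ∨ b = d) : 6 ≤ G.egirth := by
  refine natCast_le_egirth_iff_cycleGraph_free.2 fun m hm hm6 hcontained => ?_
  have heven := even_of_cycleGraph_isContained hG (by lia) hcontained
  obtain rfl : m = 4 := by grind
  obtain ⟨φ⟩ := hcontained
  have hadj (i : Fin 4) : G.Adj (φ i) (φ (i + 1)) :=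
    φ.toHom.map_adj (cycleGraph_adj.2 (.inr (add_sub_cancel_left i 1)))
  rcases h4 (hadj 0) (hadj 1) (hadj 2) (hadj 3) with h | h <;>
    exact absurd (φ.injective h) (by decide)

end Girth

theorem kgSpectrum_subset_kgOrders (k g : ℕ) : kgSpectrum k g ⊆ kgOrders k g :=
  fun _ ⟨G, _, hG⟩ => ⟨G, hG⟩

theorem card_mem_kgSpectrum {V : Type*} [Fintype V] {G : SimpleGraph V} [G.LocallyFinite]
    {k g : ℕ} (hconn : G.Connected) (hG : IsKGGraph G k g) : Fintype.card V ∈ kgSpectrum k g := by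
  classical
  let e := G.overFinIso rfl
  refine ⟨G.overFin rfl, e.connected_iff.1 hconn, fun v => ?_, e.symm.egirth_eq.trans hG.2⟩
  rw [← e.apply_symm_apply v, e.degree_eq, ← hG.1 (e.symm v)]

section Circulant

variable {A : Type*}

theorem circulantGraph_adj_iff_sub_mem [AddGroup A] {S : Set A} (h0 : 0 ∉ S)
    (hneg : ∀ s ∈ S, -s ∈ S) {x y : A} : (circulantGraph S).Adj x y ↔ y - x ∈ S := by
  have hsymm : x - y ∈ S ↔ y - x ∈ S :=
    ⟨fun h => by simpa using hneg _ h, fun h => by simpa using hneg _ h⟩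
  rw [circulantGraph_adj, hsymm, or_self, and_iff_right_iff_imp]
  rintro h rfl
  exact h0 (by simpa using h)

theorem circulantGraph_isRegularOfDegree [AddGroup A] {S : Finset A} (h0 : 0 ∉ S)
    (hneg : ∀ s ∈ S, -s ∈ S) [(circulantGraph (S : Set A)).LocallyFinite] :
    (circulantGraph (S : Set A)).IsRegularOfDegree #S := by
  intro x
  have hnbr : (circulantGraph (S : Set A)).neighborFinset x = S.map (addRightEmbedding x) := by
    ext y
    rw [mem_neighborFinset, circulantGraph_adj_iff_sub_mem (by simpa) (by simpa)]
    simp [← eq_sub_iff_add_eq]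
  rw [← card_neighborFinset_eq_degree, hnbr, card_map]

theorem circulantGraph_connected [AddGroup A] {S : Set A} (hS : AddSubgroup.closure S = ⊤) :
    (circulantGraph S).Connected := by
  have hstep (x y : A) (hy : y ∈ S) : (circulantGraph S).Reachable x (y + x) := by
    by_cases hxy : x = y + x
    · rw [← hxy]
    · exact Adj.reachable (by simpa [hxy] using .inr hy)
  have hzero (x : A) : (circulantGraph S).Reachable 0 x := by
    have hx : x ∈ AddSubgroup.closure S := hS ▸ AddSubgroup.mem_top x
    induction hx using AddSubgroup.closure_induction_left with
    | zero => rfl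
    | add_left y hy x _ ih => exact ih.trans (hstep x y hy)
    | neg_add_cancel y hy x _ ih => exact ih.trans (by simpa using (hstep (-y + x) y hy).symm)
  exact ⟨fun x y => (hzero x).symm.trans (hzero y)⟩

variable [AddCommGroup A] [Fintype A] {S : Finset A}

theorem card_mem_kgSpectrum_three_of_triple (hS : AddSubgroup.closure (S : Set A) = ⊤)
    (h0 : 0 ∉ S) (hneg : ∀ s ∈ S, -s ∈ S) {a b : A} (ha : a ∈ S) (hb : b ∈ S) (hab : a + b ∈ S) :
    Fintype.card A ∈ kgSpectrum #S 3 := by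
  classical
  have hadj {x y : A} := circulantGraph_adj_iff_sub_mem (S := (S : Set A)) h0 hneg (x := x) (y := y)
  refine card_mem_kgSpectrum (circulantGraph_connected hS)
    ⟨circulantGraph_isRegularOfDegree h0 hneg, le_antisymm ?_ three_le_egirth⟩
  have htriangle : ¬ (circulantGraph (S : Set A)).CliqueFree 3 := fun hfree =>
    hfree {0, a, a + b} (is3Clique_triple_iff.2 ⟨hadj.2 (by simpa), hadj.2 (by simpa),
      hadj.2 (by simpa)⟩)
  rw [← four_le_egirth_iff_cliqueFree_three, not_le] at htriangle
  exact Order.le_of_lt_succ htriangle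

theorem card_mem_kgSpectrum_four_of_sumFree (hS : AddSubgroup.closure (S : Set A) = ⊤)
    (hneg : ∀ s ∈ S, -s ∈ S) (hsum : ∀ a ∈ S, ∀ b ∈ S, a + b ∉ S) {a b : A} (ha : a ∈ S)
    (hb : b ∈ S) (hne : a ≠ b) (hne' : a + b ≠ 0) : Fintype.card A ∈ kgSpectrum #S 4 := by
  classical
  have h0 : 0 ∉ S := fun h => hsum 0 h 0 h (by simpa)
  have hadj {x y : A} := circulantGraph_adj_iff_sub_mem (S := (S : Set A)) h0 hneg (x := x) (y := y)
  refine card_mem_kgSpectrum (circulantGraph_connected hS)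
    ⟨circulantGraph_isRegularOfDegree h0 hneg, le_antisymm ?_ ?_⟩
  · exact egirth_le_four (b := a) (c := a + b) (d := b) (hadj.2 (by simpa)) (hadj.2 (by simpa))
      (hadj.2 (by simpa using hneg a ha)) (hadj.2 (by simpa using hneg b hb)) hne'.symm hne
  · refine four_le_egirth_iff_cliqueFree_three.2 fun s hs => ?_
    obtain ⟨x, y, z, hxy, hxz, hyz, -⟩ := is3Clique_iff.1 hs
    refine hsum _ (hadj.1 hxy) _ (hadj.1 hyz) ?_
    simpa using hadj.1 hxz

end Circulant

section ZMod

variable {n : ℕ}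

theorem zmod_closure_eq_top {S : Set (ZMod n)} (h1 : 1 ∈ S) : AddSubgroup.closure S = ⊤ := by
  refine (AddSubgroup.eq_top_iff' _).2 fun x => ?_
  obtain ⟨k, rfl⟩ := ZMod.intCast_surjective x
  simpa using zsmul_mem (AddSubgroup.subset_closure h1) k

theorem zmod_intCast_injOn_Ico (a : ℤ) :
    Set.InjOn (Int.cast : ℤ → ZMod n) (Set.Ico a (a + n)) := by
  intro s hs t ht hst
  obtain ⟨hs, hs'⟩ := hs
  obtain ⟨ht, ht'⟩ := ht
  have hdvd := (ZMod.intCast_eq_intCast_iff_dvd_sub s t n).1 hst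
  have := Int.eq_zero_of_abs_lt_dvd hdvd (abs_lt.2 ⟨by lia, by lia⟩)
  lia

theorem zmod_intCast_ne_zero {t : ℤ} (ht : t ≠ 0) (htn : |t| < n) : (t : ZMod n) ≠ 0 := by
  rw [Ne, ZMod.intCast_zmod_eq_zero_iff_dvd]
  exact fun hdvd => ht (Int.eq_zero_of_abs_lt_dvd hdvd htn)

theorem neg_mem_image_intCast {T : Finset ℤ} (hT : ∀ t ∈ T, ∃ s ∈ T, (n : ℤ) ∣ t + s) :
    ∀ s ∈ T.image (Int.cast : ℤ → ZMod n), -s ∈ T.image (Int.cast : ℤ → ZMod n) := by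
  refine forall_mem_image.2 fun t ht => ?_
  obtain ⟨s, hs, hdvd⟩ := hT t ht
  have hsum := (ZMod.intCast_zmod_eq_zero_iff_dvd _ n).2 hdvd
  exact mem_image.2 ⟨s, hs, eq_neg_of_add_eq_zero_right (by exact_mod_cast hsum)⟩

theorem mem_kgSpectrum_three_of_window [NeZero n] {T : Finset ℤ} {a : ℤ}
    (hT : (T : Set ℤ) ⊆ Set.Ico a (a + n)) (ha : 0 ∈ Set.Ico a (a + n)) (h0 : 0 ∉ T)
    (hneg : ∀ t ∈ T, ∃ s ∈ T, (n : ℤ) ∣ t + s) (h1 : 1 ∈ T) (h2 : 2 ∈ T) :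
    n ∈ kgSpectrum #T 3 := by
  have hmem {t : ℤ} (ht : t ∈ T) : (t : ZMod n) ∈ T.image (Int.cast : ℤ → ZMod n) :=
    mem_image_of_mem _ ht
  have h0' : (0 : ZMod n) ∉ T.image (Int.cast : ℤ → ZMod n) := by
    rw [mem_image]
    rintro ⟨t, ht, ht0⟩
    exact h0 (zmod_intCast_injOn_Ico a (hT ht) ha (by simpa using ht0) ▸ ht)
  have hone : (1 : ZMod n) ∈ T.image (Int.cast : ℤ → ZMod n) := by simpa using hmem h1
  have := card_mem_kgSpectrum_three_of_triple (zmod_closure_eq_top hone) h0'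
    (neg_mem_image_intCast hneg) hone hone (by simpa [one_add_one_eq_two] using hmem h2)
  rwa [ZMod.card, card_image_of_injOn ((zmod_intCast_injOn_Ico a).mono hT)] at this

theorem mem_kgSpectrum_three {k : ℕ} (hk : 4 ≤ k) (hkn : k < n) (hn : AdmissibleOrder k n) :
    n ∈ kgSpectrum k 3 := by
  have : NeZero n := ⟨by lia⟩
  obtain ⟨j, rfl | rfl⟩ := k.even_or_odd'
  all_goals set B : Finset ℤ := (Icc (-j : ℤ) j).erase 0 with hB
  · have hcard : #B = 2 * j := by simp [hB]; lia
    rw [← hcard]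
    exact mem_kgSpectrum_three_of_window (a := -j) (by intro t; simp [hB]; lia) (by simp; lia)
      (by simp [hB]) (fun t ht => ⟨-t, by grind, by simp⟩) (by simp [hB]; lia) (by simp [hB]; lia)
  · obtain ⟨m, rfl⟩ := hn (odd_two_mul_add_one j)
    have hcard : #(insert (m : ℤ) B) = 2 * j + 1 := by
      rw [card_insert_of_notMem (by simp [hB]; lia)]
      simp [hB]; lia
    rw [← hcard]
    refine mem_kgSpectrum_three_of_window (a := -j) (by intro t; simp [hB]; lia) (by simp; lia)
      (by simp [hB]; lia) (fun t ht => ?_) (by simp [hB]; lia) (by simp [hB]; lia)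
    rcases mem_insert.1 ht with rfl | ht
    · exact ⟨m, by simp, by simp⟩
    · exact ⟨-t, by grind, by simp⟩

theorem mem_kgSpectrum_four_of_window [NeZero n] {T : Finset ℤ} {a : ℤ}
    (hT : (T : Set ℤ) ⊆ Set.Ico a (a + n)) (hneg : ∀ t ∈ T, ∃ s ∈ T, (n : ℤ) ∣ t + s)
    (hsum : ∀ r ∈ T, ∀ s ∈ T, ∀ t ∈ T, ¬ (n : ℤ) ∣ t - (r + s)) (h1 : 1 ∈ T) {u : ℤ} (hu : u ∈ T)
    (hu1 : 1 < u) (hun : u + 1 < n) : n ∈ kgSpectrum #T 4 := by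
  have hone : (1 : ZMod n) ∈ T.image (Int.cast : ℤ → ZMod n) :=
    mem_image.2 ⟨1, h1, Int.cast_one⟩
  have hne : (1 : ZMod n) ≠ u := by
    have := zmod_intCast_ne_zero (n := n) (t := u - 1) (by lia) (abs_lt.2 ⟨by lia, by lia⟩)
    grind
  have hne' : (1 + u : ZMod n) ≠ 0 := by
    exact_mod_cast zmod_intCast_ne_zero (t := 1 + u) (by lia) (abs_lt.2 ⟨by lia, by lia⟩)
  have := card_mem_kgSpectrum_four_of_sumFree (zmod_closure_eq_top hone)
    (neg_mem_image_intCast hneg) ?_ hone (mem_image_of_mem _ hu) hne hne'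
  · rwa [ZMod.card, card_image_of_injOn ((zmod_intCast_injOn_Ico a).mono hT)] at this
  · simp only [mem_image, not_exists, not_and]
    rintro _ ⟨r, hr, rfl⟩ _ ⟨s, hs, rfl⟩ t ht h
    exact hsum r hr s hs t ht ((ZMod.intCast_eq_intCast_iff_dvd_sub _ _ n).1 (by simp [h]))

theorem mem_kgSpectrum_four_of_even {k : ℕ} (hk : 4 ≤ k) (hkeven : Even k) (hkn : 3 * k ≤ n + 2) :
    n ∈ kgSpectrum k 4 := by
  have : NeZero n := ⟨by lia⟩
  obtain ⟨j, rfl⟩ := hkeven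
  set T : Finset ℤ := (Ico (-j : ℤ) j).image (2 * · + 1) with hT
  have hcard : #T = j + j := by
    rw [hT, card_image_of_injective _ fun _ _ h => by simpa using h]
    simp; lia
  have hmem {t : ℤ} : t ∈ T ↔ t % 2 = 1 ∧ -(j + j) < t ∧ t < j + j := by
    simp only [hT, mem_image, mem_Ico]
    exact ⟨by rintro ⟨i, hi, rfl⟩; lia, fun h => ⟨t / 2, by lia, by lia⟩⟩
  rw [← hcard]
  refine mem_kgSpectrum_four_of_window (a := -(j + j)) (u := 3) (fun t ht => ?_)
    (fun t ht => ⟨-t, ?_, by simp⟩) (fun r hr s hs t ht hdvd => ?_) (hmem.2 ?_) (hmem.2 ?_)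
    (by lia) (by lia)
  · have := hmem.1 ht
    exact ⟨by lia, by lia⟩
  · have := hmem.1 ht
    exact hmem.2 (by lia)
  -- The difference `t - (r + s)` is odd, hence nonzero, and smaller than `n` in absolute value.
  · have := hmem.1 hr; have := hmem.1 hs; have := hmem.1 ht
    have := Int.eq_zero_of_abs_lt_dvd hdvd (abs_lt.2 ⟨by lia, by lia⟩)
    lia
  · lia
  · lia

theorem fifteen_mem_kgSpectrum_six_four : 15 ∈ kgSpectrum 6 4 := by
  let S : Finset (ZMod 15) := {1, 4, 6, 9, 11, 14}
  exact card_mem_kgSpectrum_four_of_sumFree (S := S) (a := 1) (b := 4)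
    (zmod_closure_eq_top (by decide)) (by decide) (by decide) (by decide) (by decide) (by decide)
    (by decide)

end ZMod

/-- The Haar graph of `S`: the bipartite graph on two copies of `A` in which the left copy of `x` is
joined to the right copy of `y` when `y - x ∈ S`. -/
def haarGraph {A : Type*} [AddGroup A] (S : Set A) : SimpleGraph (A ⊕ A) where
  Adj
    | .inl x, .inr y => y - x ∈ S
    | .inr y, .inl x => y - x ∈ S
    | _, _ => False
  symm := ⟨by rintro (x | x) (y | y) h <;> exact h⟩
  loopless := ⟨by rintro (x | x) h <;> exact h⟩

/-- A Sidon set: the sums of two of its elements are distinct up to the order of the summands. -/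
def IsSidonSet {A : Type*} [Add A] (S : Set A) : Prop :=
  ∀ ⦃a⦄, a ∈ S → ∀ ⦃b⦄, b ∈ S → ∀ ⦃c⦄, c ∈ S → ∀ ⦃d⦄, d ∈ S → a + b = c + d → a = c ∨ a = d

section Haar

variable {A : Type*}

@[simp] theorem haarGraph_adj_inl_inr [AddGroup A] {S : Set A} {x y : A} :
    (haarGraph S).Adj (.inl x) (.inr y) ↔ y - x ∈ S := Iff.rfl

@[simp] theorem haarGraph_adj_inr_inl [AddGroup A] {S : Set A} {x y : A} :
    (haarGraph S).Adj (.inr y) (.inl x) ↔ y - x ∈ S := Iff.rfl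

@[simp] theorem haarGraph_not_adj_inl_inl [AddGroup A] {S : Set A} {x y : A} :
    ¬ (haarGraph S).Adj (.inl x) (.inl y) := id

@[simp] theorem haarGraph_not_adj_inr_inr [AddGroup A] {S : Set A} {x y : A} :
    ¬ (haarGraph S).Adj (.inr x) (.inr y) := id

theorem haarGraph_isBipartite [AddGroup A] (S : Set A) : (haarGraph S).IsBipartite :=
  Coloring.colorable
    (Coloring.mk Sum.isLeft (by rintro (x | x) (y | y) <;> simp) : (haarGraph S).Coloring Bool)

theorem haarGraph_isRegularOfDegree [AddGroup A] {S : Finset A}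
    [(haarGraph (S : Set A)).LocallyFinite] :
    (haarGraph (S : Set A)).IsRegularOfDegree #S := by
  rintro (x | y) <;> rw [← card_neighborFinset_eq_degree]
  · have hnbr : (haarGraph (S : Set A)).neighborFinset (.inl x) =
        S.map ((addRightEmbedding x).trans .inr) := by
      ext (y | y) <;> simp [← eq_sub_iff_add_eq]
    rw [hnbr, card_map]
  · have hnbr : (haarGraph (S : Set A)).neighborFinset (.inr y) =
        S.map (((Equiv.neg A).trans (Equiv.addRight y)).toEmbedding.trans .inl) := by
      ext (x | x) <;> simp [neg_add_eq_iff_eq_add, ← sub_eq_iff_eq_add]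
    rw [hnbr, card_map]

theorem haarGraph_connected [AddGroup A] {S : Set A} (h0 : 0 ∈ S)
    (hS : AddSubgroup.closure S = ⊤) : (haarGraph S).Connected := by
  have hflip (x : A) : (haarGraph S).Reachable (.inl x) (.inr x) := Adj.reachable (by simpa)
  have hstep (x y : A) (hy : y ∈ S) : (haarGraph S).Reachable (.inl x) (.inl (y + x)) :=
    (Adj.reachable (by simpa)).trans (hflip (y + x)).symm
  have hzero (x : A) : (haarGraph S).Reachable (.inl 0) (.inl x) := by
    have hx : x ∈ AddSubgroup.closure S := hS ▸ AddSubgroup.mem_top x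
    induction hx using AddSubgroup.closure_induction_left with
    | zero => rfl
    | add_left y hy x _ ih => exact ih.trans (hstep x y hy)
    | neg_add_cancel y hy x _ ih => exact ih.trans (by simpa using (hstep (-y + x) y hy).symm)
  have hreach : ∀ v, (haarGraph S).Reachable (.inl 0) v :=
    Sum.forall.2 ⟨hzero, fun x => (hzero x).trans (hflip x)⟩
  exact ⟨fun v w => (hreach v).symm.trans (hreach w)⟩

variable [AddCommGroup A]

theorem six_le_egirth_haarGraph {S : Set A} (hS : IsSidonSet S) : 6 ≤ (haarGraph S).egirth := by
  have key {x z y w : A} (hxy : y - x ∈ S) (hzy : y - z ∈ S) (hzw : w - z ∈ S)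
      (hxw : w - x ∈ S) : x = z ∨ y = w :=
    (hS hxy hzw hzy hxw (by abel)).imp (fun h => by simpa using h) (fun h => by simpa using h)
  refine six_le_egirth_of_isBipartite (haarGraph_isBipartite S) ?_
  rintro (x | x) (y | y) (z | z) (w | w) hxy hyz hzw hwx <;>
    simp only [haarGraph_adj_inl_inr, haarGraph_adj_inr_inl, haarGraph_not_adj_inl_inl,
      haarGraph_not_adj_inr_inr, Sum.inl.injEq, Sum.inr.injEq] at hxy hyz hzw hwx ⊢
  · exact key hxy hyz hzw hwx
  · exact (key hxy hwx hzw hyz).symm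

variable [Fintype A] {S : Finset A}

theorem card_mem_kgSpectrum_four_of_haarGraph (hS : AddSubgroup.closure (S : Set A) = ⊤)
    (h0 : 0 ∈ S) {a b c : A} (ha : a ∈ S) (hb : b ∈ S) (hc : c ∈ S) (hsum : a + c = b + b)
    (hab : a ≠ b) : Fintype.card (A ⊕ A) ∈ kgSpectrum #S 4 := by
  classical
  refine card_mem_kgSpectrum (haarGraph_connected h0 hS)
    ⟨haarGraph_isRegularOfDegree, le_antisymm ?_
      (four_le_egirth_of_isBipartite (haarGraph_isBipartite _))⟩
  refine egirth_le_four (a := .inl 0) (b := .inr a) (c := .inl (a - b)) (d := .inr b)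
    ?_ ?_ ?_ ?_ ?_ ?_
  · simpa
  · simpa
  · simpa [sub_sub_eq_add_sub, ← hsum] using hc
  · simpa
  · simpa [eq_comm, sub_eq_zero]
  · simpa

theorem card_mem_kgSpectrum_six_of_isSidonSet (hS : AddSubgroup.closure (S : Set A) = ⊤)
    (h0 : 0 ∈ S) (hsidon : IsSidonSet (S : Set A)) (hcard : 3 ≤ #S) :
    Fintype.card (A ⊕ A) ∈ kgSpectrum #S 6 := by
  classical
  refine card_mem_kgSpectrum (haarGraph_connected h0 hS)
    ⟨haarGraph_isRegularOfDegree, le_antisymm ?_ (six_le_egirth_haarGraph hsidon)⟩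
  obtain ⟨a, ha, b, hb, c, hc, hab, hac, hbc⟩ := two_lt_card.1 hcard
  refine egirth_le_of_injective (n := 3) (f := ![.inl 0, .inr a, .inl (a - b), .inr (a - b + c),
    .inl (c - b), .inr c]) ?_ ?_
  · simp only [← List.nodup_ofFn, List.ofFn_succ]
    simp [sub_eq_zero, hac, hab, hbc.symm, eq_comm (a := (0 : A))]
    grind
  · simp [Fin.forall_fin_succ, ha, hb, hc, show a - b + c - (c - b) = a by abel]

end Haar

section HaarZMod

variable {m : ℕ}

theorem two_mul_mem_kgSpectrum_four {k : ℕ} (hk : 3 ≤ k) (hkm : k ≤ m) :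
    2 * m ∈ kgSpectrum k 4 := by
  have : NeZero m := ⟨by lia⟩
  let S : Finset (ZMod m) := (Ico (0 : ℤ) k).image Int.cast
  have hinj : Set.InjOn (Int.cast : ℤ → ZMod m) (Ico (0 : ℤ) k) :=
    (zmod_intCast_injOn_Ico 0).mono (by intro t; simp; lia)
  have hcard : #S = k := by simp [S, card_image_of_injOn hinj]
  have hmem {t : ℤ} (ht : 0 ≤ t ∧ t < k) : (t : ZMod m) ∈ S := mem_image_of_mem _ (mem_Ico.2 ht)
  have hne : ((0 : ℤ) : ZMod m) ≠ (1 : ℤ) := hinj.ne (by simp; lia) (by simp; lia) zero_ne_one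
  have hone : (1 : ZMod m) ∈ S := by exact_mod_cast hmem (t := 1) (by lia)
  have := card_mem_kgSpectrum_four_of_haarGraph (zmod_closure_eq_top hone)
    (by exact_mod_cast hmem (t := 0) (by lia)) (hmem (t := 0) (by lia)) (hmem (t := 1) (by lia))
    (hmem (t := 2) (by lia)) (by norm_num) hne
  rwa [Fintype.card_sum, ZMod.card, ← two_mul, hcard] at this

theorem isSidonSet_image_intCast {T : Finset ℤ} (hT : IsSidonSet (T : Set ℤ)) {L : ℤ}
    (hTL : T ⊆ Icc 0 L) (hL : 2 * L < m) :
    IsSidonSet ((Int.cast : ℤ → ZMod m) '' T) := by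
  simp only [IsSidonSet, Set.forall_mem_image, mem_coe]
  intro a ha b hb c hc d hd h
  have := mem_Icc.1 (hTL ha); have := mem_Icc.1 (hTL hb)
  have := mem_Icc.1 (hTL hc); have := mem_Icc.1 (hTL hd)
  have hsum : a + b = c + d := zmod_intCast_injOn_Ico (n := m) 0 ⟨by lia, by lia⟩
    ⟨by lia, by lia⟩ (by exact_mod_cast h)
  exact (hT ha hb hc hd hsum).imp (congrArg _) (congrArg _)

theorem two_mul_mem_kgSpectrum_six {T : Finset ℤ} (hT : IsSidonSet (T : Set ℤ)) {L : ℤ}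
    (hTL : T ⊆ Icc 0 L) (hL : 2 * L < m) (h0 : 0 ∈ T) (h1 : 1 ∈ T) (hcard : 3 ≤ #T) :
    2 * m ∈ kgSpectrum #T 6 := by
  have hL0 : 0 ≤ L := (mem_Icc.1 (hTL h0)).2
  have : NeZero m := ⟨by lia⟩
  have hinj : Set.InjOn (Int.cast : ℤ → ZMod m) T :=
    (zmod_intCast_injOn_Ico 0).mono fun t ht => by
      have := mem_Icc.1 (hTL ht)
      exact ⟨by lia, by lia⟩
  rw [← card_image_of_injOn hinj] at hcard ⊢
  have := card_mem_kgSpectrum_six_of_isSidonSet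
    (zmod_closure_eq_top (mem_image.2 ⟨1, h1, Int.cast_one⟩)) (mem_image.2 ⟨0, h0, Int.cast_zero⟩)
    (by simpa using isSidonSet_image_intCast hT hTL hL) hcard
  rwa [Fintype.card_sum, ZMod.card, ← two_mul] at this

theorem two_mul_mem_kgSpectrum_five_six (hm : 23 ≤ m) : 2 * m ∈ kgSpectrum 5 6 := by
  have hcard : #({0, 1, 4, 9, 11} : Finset ℤ) = 5 := rfl
  rw [← hcard]
  exact two_mul_mem_kgSpectrum_six (L := 11) (by simp only [IsSidonSet, mem_coe]; decide)
    (by decide) (by lia) (by decide) (by decide) (by decide)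

theorem forty_two_mem_kgSpectrum_five_six : 42 ∈ kgSpectrum 5 6 := by
  let S : Finset (ZMod 21) := {0, 1, 4, 14, 16}
  exact card_mem_kgSpectrum_six_of_isSidonSet (S := S) (zmod_closure_eq_top (by simp [S]))
    (by decide) (by simp only [IsSidonSet, mem_coe]; decide) (by decide)

end HaarZMod

section LowerBounds

variable {V : Type*} {G : SimpleGraph V}

theorem not_adj_of_adj_of_adj (hG : 4 ≤ G.egirth) {a b c : V} (hab : G.Adj a b)
    (hbc : G.Adj b c) : ¬ G.Adj c a := fun hca => by
  classical
  exact four_le_egirth_iff_cliqueFree_three.1 hG {a, b, c}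
    (is3Clique_triple_iff.2 ⟨hab, hca.symm, hbc⟩)

theorem not_closed_walk_five (hG : 6 ≤ G.egirth) {a b c d e : V} (hab : G.Adj a b)
    (hbc : G.Adj b c) (hcd : G.Adj c d) (hde : G.Adj d e) : ¬ G.Adj e a := by
  intro hea
  have htriangle {x y z : V} (hxy : G.Adj x y) (hyz : G.Adj y z) : ¬ G.Adj z x :=
    not_adj_of_adj_of_adj (le_trans (by decide) hG) hxy hyz
  have hnodup : [a, b, c, d, e].Nodup := by
    have := hab.ne; have := hbc.ne; have := hcd.ne; have := hde.ne; have := hea.ne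
    have hac : a ≠ c := by rintro rfl; exact htriangle hcd hde hea
    have had : a ≠ d := by rintro rfl; exact htriangle hab hbc hcd
    have hbd : b ≠ d := by rintro rfl; exact htriangle hab hde hea
    have hbe : b ≠ e := by rintro rfl; exact htriangle hbc hcd hde
    have hce : c ≠ e := by rintro rfl; exact htriangle hab hbc hea
    simp; grind
  exact absurd (hG.trans (egirth_le_five hab hbc hcd hde hea hnodup)) (by decide)

variable [Fintype V] [DecidableRel G.Adj] {k : ℕ}

theorem degree_add_degree_le_card (hG : 4 ≤ G.egirth) {u v : V} (huv : G.Adj u v) :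
    G.degree u + G.degree v ≤ Fintype.card V := by
  classical
  have hdisj : Disjoint (G.neighborFinset u) (G.neighborFinset v) := by
    simp only [Finset.disjoint_left, mem_neighborFinset]
    exact fun w huw hvw => not_adj_of_adj_of_adj hG huv hvw huw.symm
  rw [← card_neighborFinset_eq_degree, ← card_neighborFinset_eq_degree,
    ← card_union_of_disjoint hdisj]
  exact card_le_univ _

theorem two_mul_le_card (hreg : G.IsRegularOfDegree k) [Nonempty V] (hG : 4 ≤ G.egirth) :
    2 * k ≤ Fintype.card V := by
  obtain ⟨u⟩ := ‹Nonempty V›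
  rcases Nat.eq_zero_or_pos k with rfl | hk
  · lia
  obtain ⟨v, huv⟩ := (G.degree_pos_iff_exists_adj u).1 (hreg u ▸ hk)
  have := degree_add_degree_le_card hG huv
  rw [hreg u, hreg v] at this
  lia

theorem even_card_of_odd (hreg : G.IsRegularOfDegree k) (hk : Odd k) :
    Even (Fintype.card V) := by
  have hsum := G.sum_degrees_eq_twice_card_edges
  simp only [hreg _, sum_const, smul_eq_mul, card_univ] at hsum
  exact (Nat.even_mul.1 (hsum ▸ even_two_mul _)).resolve_right (Nat.not_even_iff_odd.2 hk)

theorem exists_isBipartiteWith_compl [DecidableEq V] (hreg : G.IsRegularOfDegree k) (hk : 0 < k)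
    (hG : G.IsBipartite) :
    ∃ s : Finset V, G.IsBipartiteWith ↑s ↑sᶜ ∧ 2 * #s = Fintype.card V := by
  obtain ⟨c⟩ := hG
  let s : Finset V := {v | c v = 0}
  have hbip : G.IsBipartiteWith ↑s ↑sᶜ := by
    refine ⟨by simp [disjoint_compl_right], fun v w hvw => ?_⟩
    have hne := c.valid hvw
    simp only [s, coe_filter, coe_compl, Set.mem_compl_iff, Set.mem_ofPred_eq, mem_univ, true_and]
    lia
  have hsum := isBipartiteWith_sum_degrees_eq hbip
  simp only [hreg _, sum_const, smul_eq_mul] at hsum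
  have hcompl := card_add_card_compl s
  rw [← Nat.eq_of_mul_eq_mul_right hk hsum] at hcompl
  exact ⟨s, hbip, by lia⟩

/-- By Andrásfai, Erdős and Sós, a denser graph would be bipartite, hence of even order. -/
theorem five_mul_le_two_mul_card_of_odd (hreg : G.IsRegularOfDegree k) (hG : 4 ≤ G.egirth)
    (hodd : Odd (Fintype.card V)) : 5 * k ≤ 2 * Fintype.card V := by
  classical
  by_contra! hlt
  have : Nonempty V := Fintype.card_pos_iff.1 hodd.pos
  have hbip : G.IsBipartite := by
    refine colorable_of_cliqueFree_lt_minDegree (four_le_egirth_iff_cliqueFree_three.1 hG) ?_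
    rw [hreg.minDegree_eq]
    lia
  obtain ⟨s, -, hs⟩ := exists_isBipartiteWith_compl hreg (by lia) hbip
  exact Nat.not_even_iff_odd.2 hodd ⟨#s, by lia⟩

end LowerBounds

section DistanceTwo

variable {V : Type*} [Fintype V] [DecidableEq V] {G : SimpleGraph V} [DecidableRel G.Adj] {k : ℕ}
  {u v w z : V}

variable (G) in
/-- The vertices other than `u` that share a neighbour with `u`. In a triangle-free graph these are
the vertices at distance two from `u`. -/
def secondNeighborFinset (u : V) : Finset V := {z | z ≠ u ∧ ∃ v, G.Adj u v ∧ G.Adj z v}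

variable (G) in
/-- The vertices at distance at least three from `u`, or in another component. -/
def farFinset (u : V) : Finset V := {z | z ≠ u ∧ ¬ G.Adj u z ∧ z ∉ secondNeighborFinset G u}

theorem mem_secondNeighborFinset :
    z ∈ secondNeighborFinset G u ↔ z ≠ u ∧ ∃ v, G.Adj u v ∧ G.Adj z v := by
  simp [secondNeighborFinset]

theorem mem_secondNeighborFinset_comm :
    z ∈ secondNeighborFinset G u ↔ u ∈ secondNeighborFinset G z := by
  simp only [mem_secondNeighborFinset, ne_comm, and_comm]

theorem mem_farFinset :
    z ∈ farFinset G u ↔ z ≠ u ∧ ¬ G.Adj u z ∧ z ∉ secondNeighborFinset G u := by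
  simp [farFinset]

theorem notMem_secondNeighborFinset_of_adj (hG : 4 ≤ G.egirth) (huz : G.Adj u z) :
    z ∉ secondNeighborFinset G u := fun hz => by
  obtain ⟨-, v, huv, hzv⟩ := mem_secondNeighborFinset.1 hz
  exact not_adj_of_adj_of_adj hG huv hzv.symm huz.symm

theorem not_adj_of_mem_secondNeighborFinset (hG : 6 ≤ G.egirth)
    (hw : w ∈ secondNeighborFinset G u) (hz : z ∈ secondNeighborFinset G u) : ¬ G.Adj w z := by
  obtain ⟨-, a, hua, hwa⟩ := mem_secondNeighborFinset.1 hw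
  obtain ⟨-, b, hub, hzb⟩ := mem_secondNeighborFinset.1 hz
  exact fun hwz => not_closed_walk_five hG hua hwa.symm hwz hzb hub.symm

theorem card_secondNeighborFinset (hreg : G.IsRegularOfDegree k) (hG : 5 ≤ G.egirth) (u : V) :
    #(secondNeighborFinset G u) = k * (k - 1) := by
  have hunion : secondNeighborFinset G u =
      (G.neighborFinset u).biUnion fun v => (G.neighborFinset v).erase u := by
    ext z
    simp only [mem_secondNeighborFinset, mem_biUnion, mem_neighborFinset, mem_erase, G.adj_comm z]
    grind
  have hdisj : (G.neighborFinset u : Set V).PairwiseDisjoint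
      fun v => (G.neighborFinset v).erase u := by
    refine fun v hv w hw hvw => Finset.disjoint_left.2 fun z hzv hzw => hvw ?_
    simp only [mem_coe, mem_neighborFinset, mem_erase] at hv hw hzv hzw
    exact eq_of_adj_of_adj hG hzv.1.symm hv hzv.2.symm hw hzw.2.symm
  have hcard : ∀ v ∈ G.neighborFinset u, #((G.neighborFinset v).erase u) = k - 1 := by
    intro v hv
    rw [card_erase_of_mem (by simpa [adj_comm] using hv), card_neighborFinset_eq_degree, hreg]
  rw [hunion, card_biUnion hdisj, sum_congr rfl hcard, sum_const, smul_eq_mul,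
    card_neighborFinset_eq_degree, hreg]

theorem card_farFinset_add (hreg : G.IsRegularOfDegree k) (hG : 5 ≤ G.egirth) (u : V) :
    #(farFinset G u) + (1 + k + k * (k - 1)) = Fintype.card V := by
  have hfar : farFinset G u = (insert u (G.neighborFinset u) ∪ secondNeighborFinset G u)ᶜ := by
    ext z
    simp only [mem_farFinset, mem_compl, mem_union, mem_insert, mem_neighborFinset, not_or,
      and_assoc, ne_eq]
  have hdisj : Disjoint (insert u (G.neighborFinset u)) (secondNeighborFinset G u) := by
    refine Finset.disjoint_left.2 fun z hz => ?_
    obtain rfl | hz := mem_insert.1 hz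
    · simp [mem_secondNeighborFinset]
    · exact notMem_secondNeighborFinset_of_adj (le_trans (by decide) hG)
        ((mem_neighborFinset ..).1 hz)
  have hball : #(insert u (G.neighborFinset u)) = k + 1 := by
    rw [card_insert_of_notMem (by simp), card_neighborFinset_eq_degree, hreg]
  have := card_compl_add_card (insert u (G.neighborFinset u) ∪ secondNeighborFinset G u)
  rw [← hfar, card_union_of_disjoint hdisj, hball, card_secondNeighborFinset hreg hG] at this
  lia

theorem farFinset_inter_secondNeighborFinset (hG : 6 ≤ G.egirth) (huv : G.Adj u v) :
    farFinset G u ∩ secondNeighborFinset G v =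
      secondNeighborFinset G v \ (G.neighborFinset u).erase v := by
  ext z
  simp only [mem_inter, mem_farFinset, mem_sdiff, mem_erase, mem_neighborFinset]
  refine ⟨fun ⟨⟨_, hnuz, _⟩, hzv⟩ => ⟨hzv, fun h => hnuz h.2⟩, fun ⟨hzv, hnuz⟩ => ?_⟩
  obtain ⟨hne, w, hvw, hzw⟩ := mem_secondNeighborFinset.1 hzv
  refine ⟨⟨?_, fun huz => hnuz ⟨hne, huz⟩, fun hzu => ?_⟩, hzv⟩
  · rintro rfl
    exact notMem_secondNeighborFinset_of_adj (le_trans (by decide) hG) huv.symm hzv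
  · obtain ⟨-, x, hux, hzx⟩ := mem_secondNeighborFinset.1 hzu
    exact not_closed_walk_five hG huv hvw hzw.symm hzx hux.symm

theorem card_farFinset_sdiff_add (hreg : G.IsRegularOfDegree k) (hG : 6 ≤ G.egirth)
    (huv : G.Adj u v) :
    #(farFinset G u \ secondNeighborFinset G v) + 2 * (k * (k - 1) + 1) = Fintype.card V := by
  have hG5 : 5 ≤ G.egirth := le_trans (by decide) hG
  have hsub : (G.neighborFinset u).erase v ⊆ secondNeighborFinset G v := by
    intro z hz
    rw [mem_erase, mem_neighborFinset] at hz
    exact mem_secondNeighborFinset.2 ⟨hz.1, u, huv.symm, hz.2.symm⟩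
  have hinter := congrArg card (farFinset_inter_secondNeighborFinset hG huv)
  rw [card_sdiff_of_subset hsub, card_secondNeighborFinset hreg hG5, card_erase_of_mem (by simpa),
    card_neighborFinset_eq_degree, hreg] at hinter
  have hpos : 0 < k := hreg u ▸ (G.degree_pos_iff_exists_adj u).2 ⟨v, huv⟩
  have hle : k - 1 ≤ k * (k - 1) := Nat.le_mul_of_pos_left _ hpos
  have hfar := card_farFinset_add hreg hG5 u
  have hsplit := card_sdiff_add_card_inter (farFinset G u) (secondNeighborFinset G v)
  lia

omit [DecidableEq V] in
theorem moore_bound_of_six_le_egirth [Nonempty V] (hreg : G.IsRegularOfDegree k) (hk : 0 < k)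
    (hG : 6 ≤ G.egirth) : 2 * (k * (k - 1) + 1) ≤ Fintype.card V := by
  classical
  obtain ⟨u⟩ := ‹Nonempty V›
  obtain ⟨v, huv⟩ := (G.degree_pos_iff_exists_adj u).1 (hreg u ▸ hk)
  exact (Nat.le_add_left _ _).trans_eq (card_farFinset_sdiff_add hreg hG huv)

theorem card_filter_mem_secondNeighborFinset_comm (hG : 5 ≤ G.egirth) (huz : ¬ G.Adj u z) :
    #{v ∈ G.neighborFinset u | z ∈ secondNeighborFinset G v} =
      #{w ∈ G.neighborFinset z | u ∈ secondNeighborFinset G w} := by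
  have hunique : ∀ {x y : V}, ¬ G.Adj x y →
      ∀ v ∈ {v ∈ G.neighborFinset x | y ∈ secondNeighborFinset G v},
        #{w ∈ {w ∈ G.neighborFinset y | x ∈ secondNeighborFinset G w} | G.Adj v w} = 1 := by
    intro x y hxy v hv
    simp only [mem_filter, mem_neighborFinset, mem_secondNeighborFinset] at hv
    obtain ⟨hxv, hyv, w, hvw, hyw⟩ := hv
    refine card_eq_one.2 ⟨w, eq_singleton_iff_unique_mem.2 ⟨?_, fun w' hw' => ?_⟩⟩
    · simp only [mem_filter, mem_neighborFinset, mem_secondNeighborFinset]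
      exact ⟨⟨hyw, by rintro rfl; exact hxy hyw.symm, v, hvw.symm, hxv⟩, hvw⟩
    · simp only [mem_filter, mem_neighborFinset] at hw'
      exact eq_of_adj_of_adj hG hyv hw'.1.1 hw'.2 hyw hvw
  rw [← mul_one (card _), ← mul_one (card (filter _ (G.neighborFinset z)))]
  refine card_mul_eq_card_mul G.Adj (hunique huz) fun w hw => ?_
  simpa only [bipartiteBelow, G.adj_comm w] using hunique (fun hzu => huz hzu.symm) w hw

end DistanceTwo

section VertexCover

variable {V : Type*} [Fintype V] {H : SimpleGraph V} [DecidableRel H.Adj] {C : Finset V} {z : V}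

theorem card_edgeFinset_le_sum_degree (hC : H.IsVertexCover C) :
    #H.edgeFinset ≤ ∑ x ∈ C, H.degree x := by
  classical
  have hsub : H.edgeFinset ⊆ C.biUnion fun x => H.incidenceFinset x := by
    intro e he
    induction e with | _ a b
    rw [mem_edgeFinset, mem_edgeSet] at he
    rw [mem_biUnion]
    rcases hC he with ha | hb
    · exact ⟨a, ha, by simpa [mk'_mem_incidenceSet_left_iff] using he⟩
    · exact ⟨b, hb, by simpa [mk'_mem_incidenceSet_right_iff] using he⟩
  simpa only [card_incidenceFinset_eq_degree] using (card_le_card hsub).trans card_biUnion_le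

theorem degree_le_card_of_notMem (hC : H.IsVertexCover C) (hz : z ∉ C) : H.degree z ≤ #C := by
  rw [← card_neighborFinset_eq_degree]
  exact card_le_card fun y hy => (hC ((mem_neighborFinset ..).1 hy)).resolve_left hz

theorem eq_or_eq_of_adj_of_card_edgeFinset_le (hz : #H.edgeFinset ≤ H.degree z) {a b : V}
    (hab : H.Adj a b) : z = a ∨ z = b := by
  classical
  have hinc := eq_of_subset_of_card_le (H.incidenceFinset_subset z)
    (hz.trans_eq (card_incidenceFinset_eq_degree ..).symm)
  have hmem : s(a, b) ∈ H.incidenceFinset z := hinc ▸ mem_edgeFinset.2 hab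
  exact Sym2.mem_iff.1 ((mem_incidenceFinset ..).1 hmem).2

end VertexCover

section ExcessTwo

variable {V : Type*} [Fintype V] [DecidableEq V] {G : SimpleGraph V} [DecidableRel G.Adj] {k : ℕ}
  {u v z : V}

variable (G) in
/-- The graph of the edges of `G` that join two vertices far from `u`. It keeps the whole vertex
type, so that the remaining vertices are isolated. -/
def farGraph (u : V) : SimpleGraph V where
  Adj a b := G.Adj a b ∧ a ∈ farFinset G u ∧ b ∈ farFinset G u
  symm.symm _ _ h := ⟨h.1.symm, h.2.2, h.2.1⟩

instance : DecidableRel (farGraph G u).Adj :=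
  fun a b => inferInstanceAs (Decidable (G.Adj a b ∧ a ∈ farFinset G u ∧ b ∈ farFinset G u))

theorem farGraph_adj {a b : V} :
    (farGraph G u).Adj a b ↔ G.Adj a b ∧ a ∈ farFinset G u ∧ b ∈ farFinset G u := Iff.rfl

theorem degree_farGraph (hreg : G.IsRegularOfDegree k) (hG : 5 ≤ G.egirth)
    (hz : z ∈ farFinset G u) :
    (farGraph G u).degree z = #{v ∈ G.neighborFinset u | z ∉ secondNeighborFinset G v} := by
  obtain ⟨hzu, huz, hz2⟩ := mem_farFinset.1 hz
  have hneighbor : (farGraph G u).neighborFinset z =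
      {w ∈ G.neighborFinset z | u ∉ secondNeighborFinset G w} := by
    ext w
    have hfar : G.Adj z w → (w ∈ farFinset G u ↔ u ∉ secondNeighborFinset G w) := by
      intro hzw
      have hwu : w ≠ u := by rintro rfl; exact huz hzw.symm
      have huw : ¬ G.Adj u w := fun huw => hz2 (mem_secondNeighborFinset.2 ⟨hzu, w, huw, hzw⟩)
      simp [mem_farFinset, hwu, huw, mem_secondNeighborFinset_comm (u := u)]
    simp only [farGraph_adj, mem_neighborFinset, mem_filter, hz, true_and]
    exact and_congr_right hfar
  have hsplit (x y : V) := card_filter_add_card_filter_not (s := G.neighborFinset x)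
    fun v => y ∈ secondNeighborFinset G v
  simp only [card_neighborFinset_eq_degree, hreg _] at hsplit
  rw [← card_neighborFinset_eq_degree, hneighbor]
  have := card_filter_mem_secondNeighborFinset_comm hG huz
  have := hsplit u z
  have := hsplit z u
  lia

theorem two_mul_card_edgeFinset_farGraph (hreg : G.IsRegularOfDegree k) (hG : 6 ≤ G.egirth)
    {e : ℕ} (hcard : Fintype.card V = 2 * (k * (k - 1) + 1) + e) :
    2 * #(farGraph G u).edgeFinset = k * e := by
  have hdegree : ∀ z, (farGraph G u).degree z =
      #{v ∈ G.neighborFinset u | z ∈ farFinset G u \ secondNeighborFinset G v} := by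
    intro z
    by_cases hz : z ∈ farFinset G u
    · simpa only [mem_sdiff, hz, true_and] using
        degree_farGraph hreg (le_trans (by decide) hG) hz
    · simp [← card_neighborFinset_eq_degree, Finset.ext_iff, farGraph_adj, hz]
  rw [← sum_degrees_eq_twice_card_edges, sum_congr rfl fun z _ => hdegree z,
    ← hreg u, ← card_neighborFinset_eq_degree, ← smul_eq_mul, ← sum_const]
  refine (sum_card_bipartiteAbove_eq_sum_card_bipartiteBelow
    fun z v => z ∈ farFinset G u \ secondNeighborFinset G v).trans (sum_congr rfl fun v hv => ?_)
  have := card_farFinset_sdiff_add hreg hG ((mem_neighborFinset ..).1 hv)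
  simp only [bipartiteBelow, filter_univ_mem]
  lia

theorem isVertexCover_farGraph (hG : 6 ≤ G.egirth) (u v : V) :
    (farGraph G u).IsVertexCover ↑(farFinset G u \ secondNeighborFinset G v) := by
  rintro a b ⟨hab, ha, hb⟩
  simp only [coe_sdiff, Set.mem_sdiff, mem_coe, ha, hb, true_and]
  by_contra! h
  exact not_adj_of_mem_secondNeighborFinset hG h.1 h.2 hab

theorem exists_star_of_excess_two (hreg : G.IsRegularOfDegree k) (hG : 6 ≤ G.egirth) (hk : 5 ≤ k)
    (hcard : Fintype.card V = 2 * (k * (k - 1) + 1) + 2) (u : V) :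
    ∃ z ∈ farFinset G u, (∀ y, G.Adj z y → y ∈ farFinset G u) ∧
      ∀ a b, (farGraph G u).Adj a b → z = a ∨ z = b := by
  have hcover := isVertexCover_farGraph hG u
  have htwo : ∀ v, G.Adj u v → #(farFinset G u \ secondNeighborFinset G v) = 2 := by
    intro v huv
    have := card_farFinset_sdiff_add hreg hG huv
    lia
  have hedges := two_mul_card_edgeFinset_farGraph (u := u) hreg hG hcard
  obtain ⟨z, hz, hdegree⟩ : ∃ z ∈ farFinset G u, 2 < (farGraph G u).degree z := by
    obtain ⟨v, huv⟩ := (G.degree_pos_iff_exists_adj u).1 (hreg u ▸ (by lia))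
    by_contra! hle
    have hsum := sum_le_card_nsmul (farFinset G u \ secondNeighborFinset G v)
      (fun z => (farGraph G u).degree z) 2 fun z hz => hle z (mem_sdiff.1 hz).1
    rw [htwo v huv] at hsum
    have := card_edgeFinset_le_sum_degree (hcover v)
    lia
  have hmem : ∀ v ∈ G.neighborFinset u, z ∉ secondNeighborFinset G v := by
    intro v hv
    by_contra hzv
    have := degree_le_card_of_notMem (hcover v) (z := z) fun h => (mem_sdiff.1 h).2 hzv
    rw [htwo v ((mem_neighborFinset ..).1 hv)] at this
    lia
  have hdegree_eq : (farGraph G u).degree z = k := by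
    rw [degree_farGraph hreg (le_trans (by decide) hG) hz, filter_true_of_mem hmem,
      card_neighborFinset_eq_degree, hreg]
  have hneighbor : (farGraph G u).neighborFinset z = G.neighborFinset z := by
    refine eq_of_subset_of_card_le (fun y hy => ?_) ?_
    · exact (mem_neighborFinset ..).2 ((mem_neighborFinset ..).1 hy).1
    · rw [card_neighborFinset_eq_degree, card_neighborFinset_eq_degree, hdegree_eq, hreg]
  refine ⟨z, hz, fun y hzy => ?_, fun a b => eq_or_eq_of_adj_of_card_edgeFinset_le (by lia)⟩
  have hy : y ∈ (farGraph G u).neighborFinset z := hneighbor ▸ (mem_neighborFinset ..).2 hzy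
  exact ((mem_neighborFinset ..).1 hy).2.2

omit [DecidableEq V] in
/-- The far edges form a star with centre `z`, and then `u`, `z` and the vertices at distance two
from `u` make up one side of a bipartition. -/
theorem isBipartite_of_excess_two (hreg : G.IsRegularOfDegree k) (hG : 6 ≤ G.egirth) (hk : 5 ≤ k)
    (hcard : Fintype.card V = 2 * (k * (k - 1) + 1) + 2) : G.IsBipartite := by
  classical
  have hG4 : 4 ≤ G.egirth := le_trans (by decide) hG
  obtain ⟨u⟩ : Nonempty V := Fintype.card_pos_iff.1 (by lia)
  obtain ⟨z, hz, hzfar, hstar⟩ := exists_star_of_excess_two hreg hG hk hcard u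
  obtain ⟨hzu, huz, hz2⟩ := mem_farFinset.1 hz
  let s : Set V := {x | x = u ∨ x = z ∨ x ∈ secondNeighborFinset G u}
  have hu : ∀ y, G.Adj u y → y ∉ s := by
    rintro y huy (rfl | rfl | hy)
    exacts [huy.ne rfl, huz huy, notMem_secondNeighborFinset_of_adj hG4 huy hy]
  have hz' : ∀ y, G.Adj z y → y ∉ s := by
    rintro y hzy (rfl | rfl | hy)
    exacts [huz hzy.symm, hzy.ne rfl, (mem_farFinset.1 (hzfar y hzy)).2.2 hy]
  have hin : ∀ x ∈ s, ∀ y, G.Adj x y → y ∉ s := by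
    rintro x (rfl | rfl | hx) y hxy hy
    · exact hu y hxy hy
    · exact hz' y hxy hy
    rcases hy with rfl | rfl | hy
    · exact hu x hxy.symm (.inr (.inr hx))
    · exact hz' x hxy.symm (.inr (.inr hx))
    · exact not_adj_of_mem_secondNeighborFinset hG hx hy hxy
  have hfar : ∀ x ∉ s, ∀ y ∉ s, G.Adj x y → x ∈ farFinset G u := by
    intro x hx y hy hxy
    simp only [s, Set.mem_ofPred_eq, not_or] at hx hy
    exact mem_farFinset.2 ⟨hx.1, fun hux =>
      hy.2.2 (mem_secondNeighborFinset.2 ⟨hy.1, x, hux, hxy.symm⟩), hx.2.2⟩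
  have hout : ∀ x ∉ s, ∀ y, G.Adj x y → y ∈ s := by
    intro x hx y hxy
    by_contra hy
    rcases hstar x y ⟨hxy, hfar x hx y hy hxy, hfar y hy x hx hxy.symm⟩ with rfl | rfl
    exacts [hx (.inr (.inl rfl)), hy (.inr (.inl rfl))]
  refine IsBipartiteWith.isBipartite (s := s) (t := sᶜ) ⟨disjoint_compl_right, fun x y hxy => ?_⟩
  by_cases hx : x ∈ s
  · exact .inl ⟨hx, hin x hx y hxy⟩
  · exact .inr ⟨hx, hout x hx y hxy⟩

end ExcessTwo

section Determinant

theorem cycleType_eq_replicate_two {ι : Type*} [Fintype ι] [DecidableEq ι] {σ : Equiv.Perm ι}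
    (hσ : Involutive σ) (hfix : ∀ i, σ i ≠ i) :
    σ.cycleType = Multiset.replicate (Fintype.card ι / 2) 2 := by
  have : Fact (Nat.Prime 2) := ⟨Nat.prime_two⟩
  have hreplicate := Equiv.Perm.cycleType_of_pow_prime_eq_one (σ := σ) (p := 2)
    (by ext i; simp [pow_two, hσ i])
  have hsupport : σ.support = univ := by ext i; simp [hfix]
  have hsum := σ.sum_cycleType
  rw [hsupport, card_univ, hreplicate, Multiset.sum_replicate, smul_eq_mul] at hsum
  rw [hreplicate, ← hsum, Nat.mul_div_cancel _ two_pos]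

/-- Fixed-point-free involutions of a finite type are all conjugate, in particular to `Sum.swap`. -/
theorem exists_equiv_sum_of_involutive {ι : Type*} [Fintype ι] {σ : Equiv.Perm ι}
    (hσ : Involutive σ) (hfix : ∀ i, σ i ≠ i) {m : ℕ} (hι : Fintype.card ι = 2 * m) :
    ∃ e : ι ≃ Fin m ⊕ Fin m, ∀ i, e (σ i) = (e i).swap := by
  classical
  let e : ι ≃ Fin m ⊕ Fin m := Fintype.equivOfCardEq (by simp [hι, two_mul])
  let τ : Equiv.Perm ι := (e.trans (Equiv.sumComm _ _)).trans e.symm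
  have hτ : Involutive τ := fun i => by simp [τ]
  have hτfix : ∀ i, τ i ≠ i := by
    intro i hi
    have hswap : (e i).swap = e i := e.symm_apply_eq.1 hi
    cases h : e i <;> simp [h] at hswap
  obtain ⟨c, hc⟩ := isConj_iff.1 (Equiv.Perm.isConj_iff_cycleType_eq.2
    ((cycleType_eq_replicate_two hσ hfix).trans (cycleType_eq_replicate_two hτ hτfix).symm))
  refine ⟨c.trans e, fun i => ?_⟩
  have hτc : c (σ i) = τ (c i) := by simp [← hc]
  simp [hτc, τ]

theorem det_fromBlocks_swap {n R : Type*} [Fintype n] [DecidableEq n] [CommRing R]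
    (A B : Matrix n n R) : (fromBlocks A B B A).det = (A + B).det * (A - B).det := by
  have hmul : fromBlocks 1 1 0 1 * fromBlocks A B B A * fromBlocks 1 (-1) 0 1 =
      fromBlocks (A + B) 0 B (A - B) := by
    simp only [fromBlocks_multiply]
    congr 1 <;> simp <;> abel
  simpa [det_mul, det_fromBlocks_zero₂₁, det_fromBlocks_zero₁₂] using congrArg det hmul

theorem det_smul_one_add_of_const {n K : Type*} [Fintype n] [DecidableEq n] [Field K] {a : K}
    (ha : a ≠ 0) (b : K) :
    (a • (1 : Matrix n n K) + of fun _ _ => b).det =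
      a ^ Fintype.card n * (1 + Fintype.card n * (b / a)) := by
  have hrank : a • (1 : Matrix n n K) + of (fun _ _ => b) =
      a • (1 + replicateCol Unit (fun _ => (1 : K)) * replicateRow Unit fun _ : n => b / a) := by
    ext i j
    simp [mul_apply, mul_add, mul_div_cancel₀, ha]
  rw [hrank, det_smul, det_one_add_replicateCol_mul_replicateRow]
  simp [dotProduct]

theorem det_smul_one_add_of_one_sub_permMatrix {ι K : Type*} [Fintype ι] [DecidableEq ι] [Field K]
    {σ : Equiv.Perm ι} (hσ : Involutive σ) (hfix : ∀ i, σ i ≠ i) {m : ℕ}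
    (hι : Fintype.card ι = 2 * m) {a : K} (ha : a ≠ 1) :
    (a • (1 : Matrix ι ι K) + of (fun _ _ => 1) - σ.permMatrix K).det =
      (a - 1) ^ m * (1 + m * (2 / (a - 1))) * (a + 1) ^ m := by
  obtain ⟨e, he⟩ := exists_equiv_sum_of_involutive hσ hfix hι
  have hσe (x) : σ (e.symm x) = e.symm x.swap := by simp [← e.apply_eq_iff_eq, he]
  have hblocks : (a • (1 : Matrix ι ι K) + of (fun _ _ => 1) - σ.permMatrix K).submatrix
      e.symm e.symm = fromBlocks (a • (1 : Matrix (Fin m) (Fin m) K) + of fun _ _ => 1)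
        (of (fun _ _ => 1) - 1) (of (fun _ _ => 1) - 1) (a • 1 + of fun _ _ => 1) := by
    ext (i | i) (j | j) <;>
      simp [hσe, one_apply, Equiv.Perm.permMatrix, PEquiv.toMatrix_apply]
  have hadd : a • (1 : Matrix (Fin m) (Fin m) K) + of (fun _ _ => 1) + (of (fun _ _ => 1) - 1) =
      (a - 1) • 1 + of fun _ _ => 2 := by
    ext i j
    simp only [Matrix.add_apply, Matrix.sub_apply, Matrix.smul_apply, of_apply, smul_eq_mul]
    ring
  have hsub : a • (1 : Matrix (Fin m) (Fin m) K) + of (fun _ _ => 1) - (of (fun _ _ => 1) - 1) =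
      (a + 1) • 1 := by
    rw [add_smul, one_smul]
    abel
  rw [← det_submatrix_equiv_self e.symm, hblocks, det_fromBlocks_swap, hadd, hsub,
    det_smul_one_add_of_const (sub_ne_zero.2 ha), det_smul, det_one, mul_one, Fintype.card_fin]

theorem isSquare_det_mul_transpose {m n R : Type*} [Fintype m] [DecidableEq m] [Fintype n]
    [CommRing R] (hmn : Fintype.card m = Fintype.card n) (N : Matrix m n R) :
    IsSquare (N * Nᵀ).det := by
  let e : m ≃ n := Fintype.equivOfCardEq hmn
  refine ⟨(N.submatrix id e).det, ?_⟩
  conv_rhs => arg 2; rw [← det_transpose]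
  rw [← det_mul, transpose_submatrix, submatrix_mul_equiv, submatrix_id_id]

end Determinant

section AntipodalGram

variable {V : Type*} [Fintype V] [DecidableEq V] {G : SimpleGraph V} [DecidableRel G.Adj] {k : ℕ}
  {s : Finset V}

theorem adjMatrix_mul_self_apply {R : Type*} [NonAssocSemiring R] (hreg : G.IsRegularOfDegree k)
    (hG : 5 ≤ G.egirth) (x y : V) :
    (G.adjMatrix R * G.adjMatrix R) x y =
      if x = y then (k : R) else if y ∈ secondNeighborFinset G x then 1 else 0 := by
  split_ifs with hxy hy
  · rw [← hxy, adjMatrix_mul_self_apply_self, hreg]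
  · obtain ⟨-, v, hxv, hyv⟩ := mem_secondNeighborFinset.1 hy
    rw [adjMatrix_mul_apply, sum_eq_single v]
    · simp [hyv.symm]
    · intro w hw hwv
      have hwy : ¬ G.Adj w y := fun hwy =>
        hwv (eq_of_adj_of_adj hG hxy ((mem_neighborFinset ..).1 hw) hwy.symm hxv hyv)
      simp [hwy]
    · simp [hxv]
  · rw [adjMatrix_mul_apply]
    refine sum_eq_zero fun v hv => ?_
    have hvy : ¬ G.Adj v y := fun hvy => hy (mem_secondNeighborFinset.2
      ⟨Ne.symm hxy, v, (mem_neighborFinset ..).1 hv, hvy.symm⟩)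
    simp [hvy]

theorem submatrix_mul_transpose_of_isBipartiteWith {R : Type*} [NonAssocSemiring R]
    (hbip : G.IsBipartiteWith ↑s ↑sᶜ) :
    (G.adjMatrix R).submatrix ((↑) : s → V) ((↑) : ↥sᶜ → V) *
        ((G.adjMatrix R).submatrix ((↑) : s → V) ((↑) : ↥sᶜ → V))ᵀ =
      (G.adjMatrix R * G.adjMatrix R).submatrix (↑) (↑) := by
  ext x y
  simp only [mul_apply, transpose_apply, submatrix_apply]
  rw [sum_coe_sort sᶜ fun v => G.adjMatrix R x v * G.adjMatrix R y v]
  simp only [G.isSymm_adjMatrix.apply y]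
  refine sum_subset (subset_univ _) fun v _ hv => ?_
  have hxv : ¬ G.Adj x v := fun hxv => hv (hbip.mem_of_mem_adj x.2 hxv)
  simp [hxv]

theorem exists_antipodal_perm (hreg : G.IsRegularOfDegree k) (hG : 5 ≤ G.egirth)
    (hbip : G.IsBipartiteWith ↑s ↑sᶜ) (hs : #s = k * (k - 1) + 2) :
    ∃ σ : Equiv.Perm s, Involutive σ ∧ (∀ x, σ x ≠ x) ∧
      ∀ x y, σ x = y ↔ y ≠ x ∧ ↑y ∉ secondNeighborFinset G x := by
  have hunique : ∀ x : s, ∃ y : s, ∀ z, y = z ↔ z ≠ x ∧ ↑z ∉ secondNeighborFinset G x := by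
    intro x
    have hsub : insert ↑x (secondNeighborFinset G x) ⊆ s := by
      refine insert_subset x.2 fun z hz => ?_
      obtain ⟨-, v, hxv, hzv⟩ := mem_secondNeighborFinset.1 hz
      exact hbip.mem_of_mem_adj' (hbip.mem_of_mem_adj x.2 hxv) hzv
    obtain ⟨y, hy⟩ : ∃ y, s \ insert ↑x (secondNeighborFinset G x) = {y} := by
      rw [← card_eq_one, card_sdiff_of_subset hsub, card_insert_of_notMem
        (by simp [mem_secondNeighborFinset]), card_secondNeighborFinset hreg hG, hs]
      lia
    simp only [Finset.ext_iff, mem_sdiff, mem_insert, not_or, mem_singleton] at hy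
    exact ⟨⟨y, ((hy y).2 rfl).1⟩, fun z => by
      rw [eq_comm, Subtype.ext_iff, ← hy z, and_iff_right z.2, ne_eq, Subtype.ext_iff]⟩
  choose σ hσ using hunique
  have hinvol : Involutive σ := fun x => by
    have := (hσ x (σ x)).1 rfl
    exact (hσ (σ x) x).2 ⟨this.1.symm, mt mem_secondNeighborFinset_comm.1 this.2⟩
  exact ⟨hinvol.toPerm, hinvol, fun x => ((hσ x (σ x)).1 rfl).1, hσ⟩

theorem submatrix_adjMatrix_mul_self_eq {R : Type*} [CommRing R]
    (hreg : G.IsRegularOfDegree k) (hG : 5 ≤ G.egirth) {σ : Equiv.Perm s}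
    (hσ : ∀ x y, σ x = y ↔ y ≠ x ∧ ↑y ∉ secondNeighborFinset G x) :
    (G.adjMatrix R * G.adjMatrix R).submatrix ((↑) : s → V) (↑) =
      ((k : R) - 1) • (1 : Matrix s s R) + of (fun _ _ => 1) - σ.permMatrix R := by
  ext x y
  have hxy := hσ x y
  simp only [submatrix_apply, adjMatrix_mul_self_apply hreg hG, Subtype.coe_inj,
    Matrix.sub_apply, Matrix.add_apply, Matrix.smul_apply, one_apply, of_apply, smul_eq_mul,
    Equiv.Perm.permMatrix, PEquiv.toMatrix_apply, Equiv.toPEquiv_apply, Option.mem_some_iff, hxy]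
  split_ifs <;> grind

omit [DecidableEq V] in
theorem isSquare_degree_of_excess_two (hreg : G.IsRegularOfDegree k) (hG : 6 ≤ G.egirth)
    (hk : 5 ≤ k) {m : ℕ} (hm : Odd m) (hkm : k * (k - 1) + 2 = 2 * m)
    (hcard : Fintype.card V = 4 * m) : IsSquare k := by
  classical
  obtain ⟨j, rfl⟩ := hm
  have hG5 : 5 ≤ G.egirth := le_trans (by decide) hG
  obtain ⟨s, hbip, hs⟩ := exists_isBipartiteWith_compl hreg (by lia)
    (isBipartite_of_excess_two hreg hG hk (by lia))
  obtain ⟨σ, hinvol, hfix, hσ⟩ := exists_antipodal_perm hreg hG5 hbip (by lia)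
  have hk5 : (5 : ℚ) ≤ k := by exact_mod_cast hk
  have hk2 : (k : ℚ) - 2 ≠ 0 := by linarith
  have hkm' : (k : ℚ) * (k - 1) + 2 = 2 * (2 * j + 1) := by
    have := congrArg (Nat.cast (R := ℚ)) hkm
    push_cast [Nat.cast_sub (show 1 ≤ k by lia)] at this
    exact this
  have hsquare := isSquare_det_mul_transpose
    (by simp only [Fintype.card_coe, card_compl]; lia)
    ((G.adjMatrix ℚ).submatrix ((↑) : s → V) ((↑) : ↥sᶜ → V))
  rw [submatrix_mul_transpose_of_isBipartiteWith hbip,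
    submatrix_adjMatrix_mul_self_eq hreg hG5 hσ, det_smul_one_add_of_one_sub_permMatrix hinvol hfix
      (m := 2 * j + 1) (by rw [Fintype.card_coe]; lia) (by linarith)] at hsquare
  have hdet : ((k : ℚ) - 1 - 1) ^ (2 * j + 1) * (1 + ↑(2 * j + 1) * (2 / (k - 1 - 1))) *
      (k - 1 + 1) ^ (2 * j + 1) = k * (k * (k - 2) ^ j * k ^ j) ^ 2 := by
    rw [sub_sub, one_add_one_eq_two, sub_add_cancel]
    push_cast
    field_simp
    rw [← hkm']
    ring
  rw [hdet] at hsquare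
  have hne : (k : ℚ) * (k - 2) ^ j * k ^ j ≠ 0 := by positivity
  rw [← Rat.isSquare_natCast_iff]
  have := hsquare.div (IsSquare.sq ((k : ℚ) * (k - 2) ^ j * k ^ j))
  rwa [mul_div_cancel_right₀ _ (pow_ne_zero 2 hne)] at this

end AntipodalGram

section Orders

variable {k g n : ℕ}

theorem AdmissibleOrder.of_even (hn : Even n) : AdmissibleOrder k n := fun _ => hn

theorem admissibleOrder_iff_even_of_odd (hk : Odd k) : AdmissibleOrder k n ↔ Even n :=
  forall_prop_of_true hk

theorem admissibleOrder_of_even_degree (hk : Even k) : AdmissibleOrder k n :=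
  fun hodd => absurd hk (Nat.not_even_iff_odd.2 hodd)

theorem pos_of_mem_kgOrders (hn : n ∈ kgOrders k g) : 0 < n := by
  obtain ⟨G, -, hG⟩ := hn
  by_contra! h0
  obtain rfl : n = 0 := by lia
  have : G.egirth = ⊤ := egirth_eq_top.2 fun v => v.elim0
  simp [this] at hG

theorem lt_of_mem_kgOrders (hn : n ∈ kgOrders k g) : k < n := by
  classical
  have h0 := pos_of_mem_kgOrders hn
  obtain ⟨G, hreg, -⟩ := hn
  have := G.degree_lt_card_verts ⟨0, h0⟩
  rwa [Fintype.card_fin, hreg] at this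

theorem admissibleOrder_of_mem_kgOrders (hn : n ∈ kgOrders k g) : AdmissibleOrder k n := by
  classical
  obtain ⟨G, hreg, -⟩ := hn
  intro hk
  simpa using even_card_of_odd hreg hk

theorem two_mul_le_of_mem_kgOrders (hg : 4 ≤ g) (hn : n ∈ kgOrders k g) : 2 * k ≤ n := by
  classical
  have : NeZero n := ⟨(pos_of_mem_kgOrders hn).ne'⟩
  obtain ⟨G, hreg, hG⟩ := hn
  simpa using two_mul_le_card hreg (hG ▸ by exact_mod_cast hg)

theorem five_mul_le_two_mul_of_mem_kgOrders (hg : 4 ≤ g) (hodd : Odd n) (hn : n ∈ kgOrders k g) :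
    5 * k ≤ 2 * n := by
  classical
  obtain ⟨G, hreg, hG⟩ := hn
  simpa using five_mul_le_two_mul_card_of_odd hreg (hG ▸ by exact_mod_cast hg) (by simpa)

theorem moore_bound_of_mem_kgOrders (hk : 0 < k) (hg : 6 ≤ g) (hn : n ∈ kgOrders k g) :
    2 * (k * (k - 1) + 1) ≤ n := by
  classical
  have : NeZero n := ⟨(pos_of_mem_kgOrders hn).ne'⟩
  obtain ⟨G, hreg, hG⟩ := hn
  simpa using moore_bound_of_six_le_egirth hreg hk (hG ▸ by exact_mod_cast hg)

theorem isSquare_of_excess_two_mem_kgOrders (hk : 5 ≤ k) (hg : 6 ≤ g) {m : ℕ} (hm : Odd m)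
    (hkm : k * (k - 1) + 2 = 2 * m) (hmem : 4 * m ∈ kgOrders k g) : IsSquare k := by
  classical
  obtain ⟨G, hreg, hG⟩ := hmem
  exact isSquare_degree_of_excess_two hreg (hG ▸ by exact_mod_cast hg) hk hm hkm (by simp)

theorem isKGThreshold_of_forall {N : ℕ} (hN : AdmissibleOrder k N)
    (hmem : ∀ n, N ≤ n → AdmissibleOrder k n → n ∈ kgSpectrum k g)
    (hgap : ∀ M < N, AdmissibleOrder k M → ∃ n, M ≤ n ∧ AdmissibleOrder k n ∧ n ∉ kgOrders k g) :
    IsKGThreshold k g N := by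
  refine ⟨⟨hN, fun n hn hadm => kgSpectrum_subset_kgOrders k g (hmem n hn hadm)⟩, ?_⟩
  rintro M ⟨hM, hall⟩
  by_contra! hlt
  obtain ⟨n, hMn, hn, hnot⟩ := hgap M hlt hM
  exact hnot (hall n hMn hn)

end Orders

section Spectra

variable {k : ℕ}

theorem kgSpectrum_three (hk : 4 ≤ k) :
    kgSpectrum k 3 = {n | AdmissibleOrder k n ∧ k + 1 ≤ n} := by
  ext n
  refine ⟨fun hn => ?_, fun ⟨hadm, hn⟩ => mem_kgSpectrum_three hk hn hadm⟩
  have hn' := kgSpectrum_subset_kgOrders k 3 hn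
  exact ⟨admissibleOrder_of_mem_kgOrders hn', lt_of_mem_kgOrders hn'⟩

theorem kgSpectrum_three_of_odd (hk : 4 ≤ k) (hodd : Odd k) :
    kgSpectrum k 3 = {n | Even n ∧ k + 1 ≤ n} := by
  simp only [kgSpectrum_three hk, admissibleOrder_iff_even_of_odd hodd]

theorem kgSpectrum_three_of_even (hk : 4 ≤ k) (heven : Even k) :
    kgSpectrum k 3 = {n | k + 1 ≤ n} := by
  simp only [kgSpectrum_three hk, admissibleOrder_of_even_degree heven, true_and]

theorem isKGThreshold_three (hk : 4 ≤ k) : IsKGThreshold k 3 (k + 1) :=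
  isKGThreshold_of_forall (fun hodd => hodd.add_one)
    (fun _ hn hadm => mem_kgSpectrum_three hk hn hadm)
    fun M hM hadm => ⟨M, le_rfl, hadm, fun h => (lt_of_mem_kgOrders h).not_ge (by lia)⟩

theorem mem_kgSpectrum_four_of_even_order (hk : 3 ≤ k) {n : ℕ} (hn : Even n) (hkn : 2 * k ≤ n) :
    n ∈ kgSpectrum k 4 := by
  obtain ⟨m, rfl⟩ := hn.exists_two_nsmul
  exact two_mul_mem_kgSpectrum_four hk (by simpa using hkn)

theorem kgSpectrum_four_of_odd (hk : 3 ≤ k) (hodd : Odd k) :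
    kgSpectrum k 4 = {n | Even n ∧ 2 * k ≤ n} := by
  ext n
  refine ⟨fun hn => ?_, fun ⟨heven, hn⟩ => mem_kgSpectrum_four_of_even_order hk heven hn⟩
  have hn' := kgSpectrum_subset_kgOrders k 4 hn
  exact ⟨admissibleOrder_of_mem_kgOrders hn' hodd, two_mul_le_of_mem_kgOrders le_rfl hn'⟩

theorem isKGThreshold_four_of_odd (hk : 3 ≤ k) (hodd : Odd k) : IsKGThreshold k 4 (2 * k) :=
  isKGThreshold_of_forall (.of_even (even_two_mul k))
    (fun _ hn hadm => mem_kgSpectrum_four_of_even_order hk (hadm hodd) hn)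
    fun M hM hadm => ⟨M, le_rfl, hadm, fun h => (two_mul_le_of_mem_kgOrders le_rfl h).not_gt hM⟩

theorem thirteen_notMem_kgOrders_six_four : 13 ∉ kgOrders 6 4 := fun h =>
  absurd (five_mul_le_two_mul_of_mem_kgOrders le_rfl (by decide) h) (by decide)

theorem mem_kgSpectrum_six_four {n : ℕ} (hn : 14 ≤ n) : n ∈ kgSpectrum 6 4 := by
  obtain rfl | rfl | hn : n = 14 ∨ n = 15 ∨ 16 ≤ n := by lia
  · exact two_mul_mem_kgSpectrum_four (m := 7) (by decide) (by decide)
  · exact fifteen_mem_kgSpectrum_six_four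
  · exact mem_kgSpectrum_four_of_even (by decide) (by decide) (by lia)

theorem kgSpectrum_six_four : kgSpectrum 6 4 = {12} ∪ {n | 14 ≤ n} := by
  ext n
  refine ⟨fun hn => ?_, ?_⟩
  · have hn' := kgSpectrum_subset_kgOrders 6 4 hn
    have h12 : 12 ≤ n := two_mul_le_of_mem_kgOrders le_rfl hn'
    have h13 : n ≠ 13 := fun h => thirteen_notMem_kgOrders_six_four (h ▸ hn')
    simp only [Set.singleton_union, Set.mem_insert_iff, Set.mem_ofPred_eq]
    lia
  · rintro (rfl | hn)
    · exact two_mul_mem_kgSpectrum_four (m := 6) (by decide) (by decide)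
    · exact mem_kgSpectrum_six_four hn

theorem isKGThreshold_six_four : IsKGThreshold 6 4 14 :=
  isKGThreshold_of_forall (.of_even (by decide)) (fun _ hn _ => mem_kgSpectrum_six_four hn)
    fun _ hM _ => ⟨13, by lia, admissibleOrder_of_even_degree (by decide),
      thirteen_notMem_kgOrders_six_four⟩

theorem forty_four_notMem_kgOrders_five_six : 44 ∉ kgOrders 5 6 := fun h =>
  Nat.prime_five.prime.not_isSquare
    (isSquare_of_excess_two_mem_kgOrders (m := 11) le_rfl le_rfl (by decide) rfl h)

theorem mem_kgSpectrum_five_six {n : ℕ} (heven : Even n) (hn : 46 ≤ n) : n ∈ kgSpectrum 5 6 := by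
  obtain ⟨m, rfl⟩ := heven.exists_two_nsmul
  exact two_mul_mem_kgSpectrum_five_six (by lia)

theorem kgSpectrum_five_six : kgSpectrum 5 6 = {42} ∪ {n | Even n ∧ 46 ≤ n} := by
  ext n
  refine ⟨fun hn => ?_, ?_⟩
  · have hn' := kgSpectrum_subset_kgOrders 5 6 hn
    have heven : Even n := admissibleOrder_of_mem_kgOrders hn' (by decide)
    have h42 : 42 ≤ n := moore_bound_of_mem_kgOrders (by decide) le_rfl hn'
    have h44 : n ≠ 44 := fun h => forty_four_notMem_kgOrders_five_six (h ▸ hn')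
    simp only [Set.singleton_union, Set.mem_insert_iff, Set.mem_ofPred_eq]
    grind
  · rintro (rfl | ⟨heven, hn⟩)
    · exact forty_two_mem_kgSpectrum_five_six
    · exact mem_kgSpectrum_five_six heven hn

theorem isKGThreshold_five_six : IsKGThreshold 5 6 46 :=
  isKGThreshold_of_forall (.of_even (by decide))
    (fun _ hn hadm => mem_kgSpectrum_five_six (hadm (by decide)) hn)
    fun M hM hadm => ⟨44, by have := hadm (by decide); grind, .of_even (by decide),
      forty_four_notMem_kgOrders_five_six⟩

end Spectra

theorem mainTheorem6 :
    (kgSpectrum 5 3 = {n : ℕ | Even n ∧ 6 ≤ n} ∧ IsKGThreshold 5 3 6) ∧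
    (kgSpectrum 5 4 = {n : ℕ | Even n ∧ 10 ≤ n} ∧ IsKGThreshold 5 4 10) ∧
    (kgSpectrum 5 6 = {42} ∪ {n : ℕ | Even n ∧ 46 ≤ n} ∧ 44 ∉ kgOrders 5 6 ∧
      IsKGThreshold 5 6 46) ∧
    (kgSpectrum 6 3 = {n : ℕ | 7 ≤ n} ∧ IsKGThreshold 6 3 7) ∧
    (kgSpectrum 6 4 = {12} ∪ {n : ℕ | 14 ≤ n} ∧ 13 ∉ kgOrders 6 4 ∧ IsKGThreshold 6 4 14) ∧
    (kgSpectrum 7 3 = {n : ℕ | Even n ∧ 8 ≤ n} ∧ IsKGThreshold 7 3 8) ∧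
    (kgSpectrum 7 4 = {n : ℕ | Even n ∧ 14 ≤ n} ∧ IsKGThreshold 7 4 14) := by
  refine ⟨⟨kgSpectrum_three_of_odd ?_ ?_, isKGThreshold_three ?_⟩,
    ⟨kgSpectrum_four_of_odd ?_ ?_, isKGThreshold_four_of_odd ?_ ?_⟩,
    ⟨kgSpectrum_five_six, forty_four_notMem_kgOrders_five_six, isKGThreshold_five_six⟩,
    ⟨kgSpectrum_three_of_even ?_ ?_, isKGThreshold_three ?_⟩,
    ⟨kgSpectrum_six_four, thirteen_notMem_kgOrders_six_four, isKGThreshold_six_four⟩,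
    ⟨kgSpectrum_three_of_odd ?_ ?_, isKGThreshold_three ?_⟩,
    ⟨kgSpectrum_four_of_odd ?_ ?_, isKGThreshold_four_of_odd ?_ ?_⟩⟩ <;> decide
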